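/- Let $q$ be a prime power and let $m\ge 2$ be an even integer. Let $R_q(1,m)$ be the first order generalized Reed–Muller code over the field $\mathbb{F}_q$ with $q$ elements, that is, the set of functions $\mathbb{F}_q^m\to\mathbb{F}_q$ whose reduced polynomial representative (of degree at most $q-1$ in each variable) has total degree at most $1$. For $f:\mathbb{F}_q^m\to\mathbb{F}_q$ let $$d(f,R_q(1,m))=\min_{g\in R_q(1,m)}\#\{x\in\mathbb{F}_q^m : f(x)\ne g(x)\},$$ and let $\rho(1,m)=\max_{f:\mathbb{F}_q^m\to\mathbb{F}_q} d(f,R_q(1,m))$ be the covering radius of $R_q(1,m)$. Then $$\rho(1,m)=(q-1)q^{m-1}-q^{\frac m2-1}.$$ Moreover, the maximum is attained by every function of the form $$f(x_1,\dots,x_m)=x_1x_2+x_3x_4+\dots+x_{m-3}x_{m-2}+a x_{m-1}^2+b x_m^2+c x_{m-1}x_m$$ with $a,b,c\in\mathbb{F}_q$, $a\neq 0$, such that the polynomial $aX^2+cX+b$ is irreducible over $\mathbb{F}_q$; that is, $d(f,R_q(1,m))=\rho(1,m)$ for every such $f$. (For $m=2$, $f=a x_1^2+b x_2^2+c x_1x_2$.)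 -/

import Mathlib

/-- The generalized Reed–Muller code `R_q(r,m)` over the finite field `F` with `q` elements: the
functions `F^m → F` whose reduced polynomial representative (the one of degree at most `q - 1` in
each variable) has total degree at most `r`. -/
noncomputable def reedMuller (F : Type*) [Field F] [Fintype F] (r m : ℕ) :
    Submodule F ((Fin m → F) → F) :=
  Submodule.map (MvPolynomial.evalₗ F (Fin m))
    (MvPolynomial.restrictTotalDegree (Fin m) F r ⊓
      MvPolynomial.restrictDegree (Fin m) F (Fintype.card F - 1))

/-- The Hamming distance `d(x, C) = min_{c ∈ C} |x - c|` from a word to a (nonempty) code. -/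
noncomputable def distToCode {ι F : Type*} [Fintype ι] [DecidableEq F]
    (x : ι → F) (C : Set (ι → F)) : ℕ :=
  sInf ((fun c => hammingDist x c) '' C)

/-- The covering radius `max_x min_{c ∈ C} |x - c|` of a (nonempty) code. -/
noncomputable def coveringRadius {ι F : Type*} [Fintype ι] [DecidableEq F]
    (C : Set (ι → F)) : ℕ :=
  sSup (Set.range fun x : ι → F => distToCode x C)

/-- The minimum in `distToCode` is attained. -/
theorem isLeast_distToCode {ι F : Type*} [Fintype ι] [DecidableEq F]
    (x : ι → F) {C : Set (ι → F)} (hC : C.Nonempty) :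
    IsLeast ((fun c => hammingDist x c) '' C) (distToCode x C) :=
  ⟨Nat.sInf_mem (hC.image _), fun _ h => Nat.sInf_le h⟩

/-- The maximum in `coveringRadius` is attained. -/
theorem isGreatest_coveringRadius {ι F : Type*} [Fintype ι] [DecidableEq F] [Nonempty F]
    {C : Set (ι → F)} (hC : C.Nonempty) :
    IsGreatest (Set.range fun x : ι → F => distToCode x C) (coveringRadius C) := by
  have hb : BddAbove (Set.range fun x : ι → F => distToCode x C) := by
    refine ⟨Fintype.card ι, ?_⟩
    rintro _ ⟨x, rfl⟩
    obtain ⟨c, hc⟩ := hC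
    exact ((isLeast_distToCode x ⟨c, hc⟩).2 ⟨c, hc, rfl⟩).trans hammingDist_le_card_fintype
  exact ⟨Nat.sSup_mem (Set.range_nonempty _) hb, fun _ h => le_csSup hb h⟩

/-- The function
`x₁x₂ + x₃x₄ + ⋯ + x_{m-3}x_{m-2} + a x_{m-1}² + b x_m² + c x_{m-1}x_m` on `F^m`
(for `m` even, `m ≥ 2`; the coordinate `x_k` is `x ⟨k - 1, _⟩`). -/
def ellipticQuadratic {F : Type*} [Field F] {m : ℕ} (hm : 2 ≤ m) (a b c : F)
    (x : Fin m → F) : F :=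
  (∑ i : Fin (m / 2 - 1), x ⟨2 * i, by omega⟩ * x ⟨2 * i + 1, by omega⟩)
    + a * x ⟨m - 2, by omega⟩ ^ 2 + b * x ⟨m - 1, by omega⟩ ^ 2
    + c * (x ⟨m - 2, by omega⟩ * x ⟨m - 1, by omega⟩)

/-! Write m = 2n+2 and count agreements with affine functions instead of distances; the claim is
that the best agreement is at least q^(m-1) + q^n for every f, with equality for elliptic forms.

Lower bound on agreement: for fixed linear part a, the agreement numbers N(a,b) sum to q^m over b,
while the sum of N(a,b)^2 over all a, b does not depend on f (`sum_sum_affineAgreement_sq`). If all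
N(a,b) ≤ T, the deficits T - N(a,b) are nonnegative, so for each a their squares sum to at most the
square of their sum. Summing over a gives (T - q^(m-1))^2 ≥ q^(2n), hence
`le_of_forall_affineAgreement_le`.

Equality: subtracting an affine function leaves a form plus linear terms. Its anisotropic binary
part has level sets of size at most q+1 (`card_conic_le`), and each hyperbolic plane propagates the
bound (`card_hyperbolic_add_le`). -/

open Finset

/-! ### Affine functions and the second moment bound -/

section Affine

variable {F : Type*} [Field F] [Fintype F]

/-- The first order generalized Reed–Muller code consists of the affine functions. -/
theorem mem_reedMuller_one_iff {m : ℕ} {g : (Fin m → F) → F} :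
    g ∈ reedMuller F 1 m ↔ ∃ (a : Fin m → F) (b : F), g = fun x => a ⬝ᵥ x + b := by
  constructor
  · rintro ⟨p, ⟨hp, -⟩, rfl⟩
    rw [SetLike.mem_coe, MvPolynomial.restrictTotalDegree,
      MvPolynomial.restrictSupport_eq_span] at hp
    induction hp using Submodule.span_induction with
    | mem p hp =>
      obtain ⟨d, hd, rfl⟩ := hp
      have hd' : d.degree ≤ 1 := hd
      rcases Nat.le_one_iff_eq_zero_or_eq_one.1 hd' with h | h
      · rw [Finsupp.degree_eq_zero_iff] at h
        subst h
        exact ⟨0, 1, by ext x; simp⟩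
      · obtain ⟨i, rfl⟩ := (Finsupp.sum_eq_one_iff d).1 h
        exact ⟨Pi.single i 1, 0, by ext x; simp [MvPolynomial.eval_monomial]⟩
    | zero => exact ⟨0, 0, by ext x; simp⟩
    | add p p' _ _ hp hp' =>
      obtain ⟨a, b, h⟩ := hp
      obtain ⟨a', b', h'⟩ := hp'
      exact ⟨a + a', b + b', by rw [map_add, h, h']; ext x; simp [add_dotProduct]; ring⟩
    | smul c p _ hp =>
      obtain ⟨a, b, h⟩ := hp
      exact ⟨c • a, c • b, by rw [map_smul, h]; ext x; simp [mul_add]⟩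
  · rintro ⟨a, b, rfl⟩
    -- Degree one monomials are already reduced, even for q = 2.
    have hq : 1 ≤ Fintype.card F - 1 := by
      have := Fintype.one_lt_card (α := F)
      omega
    refine ⟨∑ i, MvPolynomial.monomial (Finsupp.single i 1) (a i) + MvPolynomial.monomial 0 b,
      ⟨?_, ?_⟩, ?_⟩
    · refine add_mem (sum_mem fun i _ => ?_) ?_
      · exact (MvPolynomial.monomial_mem_restrictSupport F).2 (Or.inl (by simp))
      · exact (MvPolynomial.monomial_mem_restrictSupport F).2 (Or.inl (by simp))
    · refine add_mem (sum_mem fun i _ => ?_) ?_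
      · refine (MvPolynomial.monomial_mem_restrictSupport F).2 (Or.inl fun j => ?_)
        rw [Finsupp.single_apply]
        split_ifs <;> omega
      · exact (MvPolynomial.monomial_mem_restrictSupport F).2 (Or.inl (by simp))
    · ext x
      simp [MvPolynomial.eval_monomial, dotProduct]

theorem reedMuller_nonempty (r m : ℕ) :
    (reedMuller F r m : Set ((Fin m → F) → F)).Nonempty := ⟨0, zero_mem _⟩

/-- Over a finite field there is a monic quadratic polynomial `X ^ 2 + X + b` without roots. -/
theorem exists_forall_sq_add_self_add_ne_zero : ∃ b : F, ∀ x : F, x ^ 2 + x + b ≠ 0 := by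
  -- x^2 + x takes the value 0 at both 0 and -1, so on a finite field it misses some value; this
  -- works in every characteristic.
  have h : ¬ Function.Surjective fun x : F => x ^ 2 + x := by
    rw [← Finite.injective_iff_surjective]
    intro h
    have := @h 0 (-1) (by ring)
    simp at this
  simp only [Function.Surjective, not_forall, not_exists] at h
  obtain ⟨d, hd⟩ := h
  exact ⟨-d, fun x hx => hd x (by linear_combination hx)⟩

variable [DecidableEq F]

/-- The number of points at which `f` agrees with the affine function `x ↦ a ⬝ᵥ x + b`. -/
def affineAgreement {m : ℕ} (f : (Fin m → F) → F) (a : Fin m → F) (b : F) : ℕ :=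
  #{x | f x = a ⬝ᵥ x + b}

theorem hammingDist_add_affineAgreement {m : ℕ} (f : (Fin m → F) → F) (a : Fin m → F) (b : F) :
    hammingDist f (fun x => a ⬝ᵥ x + b) + affineAgreement f a b = Fintype.card F ^ m := by
  rw [hammingDist, affineAgreement, add_comm, Finset.card_filter_add_card_filter_not]
  simp

/-- A nonzero linear functional is surjective and its q fibres are cosets of the kernel. -/
theorem card_mul_card_dotProduct_eq {m : ℕ} {w : Fin m → F} (hw : w ≠ 0) (c : F) :
    Fintype.card F * #{a : Fin m → F | a ⬝ᵥ w = c} = Fintype.card F ^ m := by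
  obtain ⟨j, hj⟩ := Function.ne_iff.1 hw
  let φ : (Fin m → F) →+ F := ⟨⟨fun a => a ⬝ᵥ w, by simp⟩, fun a b => by simp [add_dotProduct]⟩
  have hφ : Function.Surjective φ := fun c =>
    ⟨Pi.single j (c / w j), by simpa [φ] using div_mul_cancel₀ c hj⟩
  have key : ∀ c', #{a : Fin m → F | a ⬝ᵥ w = c'} = #{a : Fin m → F | a ⬝ᵥ w = c} := fun c' =>
    AddMonoidHom.card_fiber_eq_of_mem_range φ (hφ c') (hφ c)
  have h := card_eq_sum_card_fiberwise (f := fun a : Fin m → F => a ⬝ᵥ w) (s := univ) (t := univ)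
    (by simp)
  simp only [key, sum_const, card_univ, smul_eq_mul] at h
  rw [← h]
  simp

/-- The second moment of the agreement numbers of a function with the affine functions. -/
theorem sum_sum_affineAgreement_sq {m : ℕ} (hm : m ≠ 0) (f : (Fin m → F) → F) :
    ∑ a, ∑ b, (affineAgreement f a b : ℤ) ^ 2 =
      (Fintype.card F : ℤ) ^ m * ((Fintype.card F : ℤ) ^ m +
        ((Fintype.card F : ℤ) ^ m - 1) * (Fintype.card F : ℤ) ^ (m - 1)) := by
  -- The square counts pairs (x, y) of agreement points; summed over b, only b = f x - a ⬝ᵥ x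
  -- contributes for a given x.
  have h1 : ∀ a : Fin m → F, ∑ b, (affineAgreement f a b : ℤ) ^ 2 =
      ∑ x, ∑ y, if a ⬝ᵥ (x - y) = f x - f y then (1 : ℤ) else 0 := by
    intro a
    have : ∀ b, (affineAgreement f a b : ℤ) ^ 2 = ∑ x, ∑ y,
        (if f x = a ⬝ᵥ x + b then (1 : ℤ) else 0) * (if f y = a ⬝ᵥ y + b then 1 else 0) := by
      intro b
      rw [← sum_mul_sum, ← sq, affineAgreement, card_filter]
      push_cast
      rfl
    simp_rw [this]
    rw [sum_comm]
    refine sum_congr rfl fun x _ => ?_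
    rw [sum_comm]
    refine sum_congr rfl fun y _ => ?_
    rw [Fintype.sum_eq_single (f x - a ⬝ᵥ x)]
    · rw [dotProduct_sub]
      simp only [add_sub_cancel, if_true, one_mul]
      congr 1
      apply propext
      exact ⟨fun h => by linear_combination h, fun h => by linear_combination h⟩
    · intro b hb
      rw [if_neg, zero_mul]
      intro h
      exact hb (by rw [h]; ring)
  simp_rw [h1]
  rw [sum_comm]
  -- The pair y = x holds for all q^m choices of a, each y ≠ x for exactly q^(m-1).
  have h2 : ∀ x : Fin m → F, ∑ a, ∑ y, (if a ⬝ᵥ (x - y) = f x - f y then (1 : ℤ) else 0) =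
      (Fintype.card F : ℤ) ^ m +
        ((Fintype.card F : ℤ) ^ m - 1) * (Fintype.card F : ℤ) ^ (m - 1) := by
    intro x
    rw [sum_comm, ← add_sum_erase _ _ (mem_univ x)]
    congr 1
    · simp
    · have : ∀ y ∈ univ.erase x, ∑ a, (if a ⬝ᵥ (x - y) = f x - f y then (1 : ℤ) else 0) =
          (Fintype.card F : ℤ) ^ (m - 1) := by
        intro y hy
        have h := card_mul_card_dotProduct_eq (sub_ne_zero.2 (ne_of_mem_erase hy).symm) (f x - f y)
        obtain ⟨k, rfl⟩ := Nat.exists_eq_succ_of_ne_zero hm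
        rw [pow_succ', Nat.mul_right_inj Fintype.card_ne_zero] at h
        rw [sum_boole, h]
        simp
      rw [sum_congr rfl this, sum_const, card_erase_of_mem (mem_univ x), card_univ, nsmul_eq_mul,
        Nat.cast_sub Fintype.card_pos]
      simp
  rw [sum_congr rfl fun x _ => h2 x]
  simp

/-- Each x is an agreement point for exactly one b, namely f x - a ⬝ᵥ x. -/
theorem sum_affineAgreement {m : ℕ} (f : (Fin m → F) → F) (a : Fin m → F) :
    ∑ b, (affineAgreement f a b : ℤ) = (Fintype.card F : ℤ) ^ m := by
  have h := card_eq_sum_card_fiberwise (f := fun x : Fin m → F => f x - a ⬝ᵥ x) (s := univ)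
    (t := univ) (by simp)
  have h' : ∀ b, affineAgreement f a b = #{x | f x - a ⬝ᵥ x = b} := by
    intro b
    rw [affineAgreement]
    congr 1
    ext x
    simp [sub_eq_iff_eq_add']
  simp_rw [h', ← Nat.cast_sum, ← h]
  simp

/-- Every function on `F ^ m` agrees with some affine function at
`q ^ (m - 1) + q ^ (m / 2 - 1)` points at least. -/
theorem le_of_forall_affineAgreement_le {n : ℕ} (f : (Fin (2 * n + 2) → F) → F) {T : ℤ}
    (hT : ∀ a b, (affineAgreement f a b : ℤ) ≤ T) :
    (Fintype.card F : ℤ) ^ (2 * n + 1) + (Fintype.card F : ℤ) ^ n ≤ T := by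
  set q : ℤ := (Fintype.card F : ℤ) with hq
  have hq1 : 1 < q := by rw [hq]; exact_mod_cast Fintype.one_lt_card (α := F)
  have hle : ∀ a, ∑ b, (T - affineAgreement f a b) ^ 2 ≤ (q * T - q ^ (2 * n + 2)) ^ 2 := by
    intro a
    refine (sum_sq_le_sq_sum_of_nonneg fun b _ => sub_nonneg.2 (hT a b)).trans_eq ?_
    rw [sum_sub_distrib, sum_affineAgreement]
    simp [hq]
  have h0 : 0 ≤ q * T - q ^ (2 * n + 2) := by
    have : 0 ≤ ∑ b, (T - affineAgreement f 0 b) := sum_nonneg fun b _ => sub_nonneg.2 (hT 0 b)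
    rw [sum_sub_distrib, sum_affineAgreement] at this
    simpa [hq] using this
  have hsum : ∀ a, ∑ b, (T - affineAgreement f a b) ^ 2 =
      q * T ^ 2 - 2 * T * q ^ (2 * n + 2) + ∑ b, (affineAgreement f a b : ℤ) ^ 2 := by
    intro a
    simp_rw [sub_sq, sum_add_distrib, sum_sub_distrib, ← mul_sum]
    rw [sum_affineAgreement]
    simp [hq]
  have h := sum_le_sum fun a (_ : a ∈ univ) => hle a
  simp_rw [hsum] at h
  rw [sum_add_distrib, sum_sum_affineAgreement_sq (by omega)] at h
  simp only [sum_const, card_univ, Fintype.card_pi, prod_const, Fintype.card_fin, nsmul_eq_mul,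
    Nat.cast_pow, ← hq] at h
  rw [← mul_add, mul_le_mul_iff_right₀ (by positivity)] at h
  have e1 : q ^ (2 * n + 2) = q * (q * (q ^ n) ^ 2) := by ring
  have e2 : q ^ (2 * n + 2 - 1) = q * (q ^ n) ^ 2 := by
    rw [show 2 * n + 2 - 1 = 2 * n + 1 by omega]; ring
  have e3 : q ^ (2 * n + 1) = q * (q ^ n) ^ 2 := by ring
  rw [e1, e2] at h
  rw [e1, ← mul_sub] at h0
  rw [e3]
  have ht : 0 ≤ T - q * (q ^ n) ^ 2 := nonneg_of_mul_nonneg_right h0 (by positivity)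
  set r := q ^ n
  -- t is the excess of T over the mean agreement q^(m-1) = q r^2; in terms of t the inequality
  -- reduces to r^2 ≤ t^2.
  obtain ⟨t, rfl⟩ : ∃ t, T = q * r ^ 2 + t := ⟨T - q * r ^ 2, by ring⟩
  have key : (q * (q - 1)) * r ^ 2 ≤ (q * (q - 1)) * t ^ 2 := by linarith
  have hpos : 0 < q * (q - 1) := mul_pos (by linarith) (by linarith)
  have := abs_le_of_sq_le_sq (le_of_mul_le_mul_left key hpos) (by linarith)
  linarith [le_abs_self r]

end Affine

/-! ### Level sets of elliptic quadratic forms -/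

section Elliptic

variable {F : Type*} [Field F] [Fintype F] [DecidableEq F]

/-- An affine conic without points at infinity has at most `q + 1` points. -/
theorem card_conic_le {a b c : F} (ha : a ≠ 0) (hirr : ∀ x, a * x ^ 2 + c * x + b ≠ 0)
    (α β d : F) :
    #{z : F × F | a * z.1 ^ 2 + b * z.2 ^ 2 + c * (z.1 * z.2) + (α * z.1 + β * z.2) = d} ≤
      Fintype.card F + 1 := by
  rcases Finset.eq_empty_or_nonempty
    {z : F × F | a * z.1 ^ 2 + b * z.2 ^ 2 + c * (z.1 * z.2) + (α * z.1 + β * z.2) = d}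
    with h | ⟨⟨u, v⟩, h⟩
  · simp [h]
  rw [mem_filter_univ] at h
  simp only at h
  -- Project from the point (u, v) of the conic: the line in direction (s, t) meets it again at
  -- parameter -l/Q, where l is the derivative at (u, v) and Q the quadratic part, nonzero in every
  -- direction. `none` is the direction (1, 0), `some k` is (k, 1), giving q + 1 directions.
  let l : F → F → F := fun s t =>
    (2 * a * u + c * v + α) * s + (2 * b * v + c * u + β) * t
  let Q : F → F → F := fun s t => a * s ^ 2 + b * t ^ 2 + c * (s * t)
  let φ : Option F → F × F := fun o => o.elim (u - l 1 0 / Q 1 0, v)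
    fun k => (u - l k 1 / Q k 1 * k, v - l k 1 / Q k 1)
  have hQ : ∀ k, Q k 1 ≠ 0 := fun k hk => hirr k (by simp only [Q] at hk; linear_combination hk)
  have hQ' : Q 1 0 ≠ 0 := by simpa [Q] using ha
  have hsub : ({z : F × F | a * z.1 ^ 2 + b * z.2 ^ 2 + c * (z.1 * z.2) +
      (α * z.1 + β * z.2) = d} : Finset (F × F)) ⊆ univ.image φ := by
    rintro ⟨x, y⟩ hz
    rw [mem_filter_univ] at hz
    simp only at hz
    simp only [mem_image, mem_univ, true_and]
    by_cases hy : y = v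
    · subst hy
      by_cases hx : x = u
      · subst hx
        -- The base point itself comes from the tangent direction, where l vanishes.
        by_cases h1 : l 1 0 = 0
        · refine ⟨none, ?_⟩
          simp only [φ, Option.elim, h1, zero_div, sub_zero]
        · refine ⟨some (-(2 * b * y + c * x + β) / l 1 0), ?_⟩
          have : l (-(2 * b * y + c * x + β) / l 1 0) 1 = 0 := by
            have h2 : l 1 0 = 2 * a * x + c * y + α := by simp [l]
            rw [h2] at h1 ⊢
            simp only [l]
            field_simp
            ring
          simp only [φ, Option.elim, this, zero_div, zero_mul, sub_zero]
      · refine ⟨none, ?_⟩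
        have : l 1 0 / Q 1 0 = u - x := by
          rw [div_eq_iff hQ']
          apply mul_left_cancel₀ (sub_ne_zero.2 hx)
          simp only [l, Q]
          linear_combination hz - h
        simp only [φ, Option.elim, this, sub_sub_cancel]
    · obtain ⟨t, rfl⟩ : ∃ t, y = v + t := ⟨y - v, by ring⟩
      have ht : t ≠ 0 := fun h => hy (by rw [h, add_zero])
      obtain ⟨k, rfl⟩ : ∃ k, x = u + k * t := ⟨(x - u) / t, by field_simp; ring⟩
      refine ⟨some k, ?_⟩
      have : l k 1 / Q k 1 = -t := by
        rw [div_eq_iff (hQ _)]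
        apply mul_left_cancel₀ ht
        simp only [l, Q]
        linear_combination hz - h
      simp only [φ, Option.elim, this, Prod.mk.injEq]
      exact ⟨by ring, by ring⟩
  refine (card_le_card hsub).trans (card_image_le.trans ?_)
  simp

theorem card_mul_eq_le (d : F) :
    #{p : F × F | p.1 * p.2 = d} ≤ (Fintype.card F - 1) + if d = 0 then Fintype.card F else 0 := by
  have hd : ({p : F × F | p.1 * p.2 = d} : Finset (F × F)) ⊆
      (univ.erase 0).image (fun x => (x, d / x)) ∪
        if d = 0 then univ.image (fun y => ((0 : F), y)) else ∅ := by
    rintro ⟨x, y⟩ h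
    rw [mem_filter_univ] at h
    simp only at h
    rw [mem_union]
    by_cases hx : x = 0
    · subst hx
      right
      rw [if_pos (by rw [← h, zero_mul])]
      simp
    · left
      simp only [mem_image, mem_erase, mem_univ, Prod.mk.injEq]
      exact ⟨x, ⟨hx, trivial⟩, rfl, by rw [← h]; field_simp⟩
  refine (card_le_card hd).trans ((card_union_le _ _).trans (add_le_add ?_ ?_))
  · exact card_image_le.trans (by simp)
  · split_ifs
    · exact card_image_le
    · simp

/-- The effect on the size of the level sets of adding a hyperbolic plane. -/
theorem card_hyperbolic_add_le {S : Type*} [Fintype S] (g : S → F) {K : ℕ}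
    (hK : ∀ c, #{z | g z = c} ≤ K) (α β c : F) :
    #{z : (F × F) × S | z.1.1 * z.1.2 + (α * z.1.1 + β * z.1.2) + g z.2 = c} ≤
      (Fintype.card F - 1) * Fintype.card S + Fintype.card F * K := by
  have h : #{z : (F × F) × S | z.1.1 * z.1.2 + (α * z.1.1 + β * z.1.2) + g z.2 = c} =
      ∑ s, #{p : F × F | p.1 * p.2 = c + α * β - g s} := by
    simp only [card_filter]
    rw [Fintype.sum_prod_type_right]
    refine sum_congr rfl fun s _ => ?_
    -- The translation absorbs the linear terms: (x + β)(y + α) = xy + αx + βy + αβ.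
    refine Fintype.sum_equiv ((Equiv.addRight β).prodCongr (Equiv.addRight α)) _ _ fun p => ?_
    congr 1
    apply propext
    simp only [Equiv.prodCongr_apply, Prod.map_fst, Prod.map_snd, Equiv.coe_addRight]
    constructor <;> intro h <;> linear_combination h
  rw [h]
  -- The extra q solutions occur only when g s = c + αβ, so for at most K values of s.
  refine (sum_le_sum fun s _ => card_mul_eq_le _).trans ?_
  rw [sum_add_distrib, sum_const, card_univ, smul_eq_mul, mul_comm, ← sum_filter, sum_const,
    smul_eq_mul, mul_comm (Fintype.card F) K]
  refine Nat.add_le_add_left (Nat.mul_le_mul_right _ ?_) _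
  refine le_trans (le_of_eq ?_) (hK (c + α * β))
  congr 1
  ext s
  simp [sub_eq_zero, eq_comm]

/-- The bound reproduces itself under one more plane: (q-1) q^(2n+2) + q (q^(2n+1) + q^n) = q^(2n+3)
+ q^(n+1). -/
theorem card_hyperbolic_sum_add_le {S : Type*} [Fintype S] (g : S → F)
    (hS : Fintype.card S = Fintype.card F ^ 2)
    (hK : ∀ c, #{z | g z = c} ≤ Fintype.card F + 1) (n : ℕ) (α β : Fin n → F) (c : F) :
    #{z : (Fin n → F × F) × S |
      ∑ i, ((z.1 i).1 * (z.1 i).2 + (α i * (z.1 i).1 + β i * (z.1 i).2)) + g z.2 = c} ≤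
      Fintype.card F ^ (2 * n + 1) + Fintype.card F ^ n := by
  induction n generalizing c with
  | zero =>
    refine le_trans (card_le_card_of_injOn Prod.snd ?_ ?_) ((hK c).trans (by simp))
    · intro z hz
      simpa using hz
    · intro z _ z' _ h
      exact Prod.ext (Subsingleton.elim _ _) h
  | succ n ih =>
    have h := card_hyperbolic_add_le _ (ih (fun i => α i.succ) (fun i => β i.succ)) (α 0) (β 0) c
    refine le_trans (card_le_card_of_injOn (fun z => (z.1 0, (fun i => z.1 i.succ, z.2)))
      ?_ ?_) (h.trans (le_of_eq ?_))
    · intro z hz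
      simpa [Fin.sum_univ_succ, add_assoc] using hz
    · intro z _ z' _ h
      simp only [Prod.mk.injEq] at h
      refine Prod.ext (funext fun i => ?_) h.2.2
      exact Fin.cases h.1 (fun i => congrFun h.2.1 i) i
    · obtain ⟨q, hq⟩ := Nat.exists_eq_succ_of_ne_zero (Fintype.card_ne_zero (α := F))
      simp only [Fintype.card_prod, Fintype.card_pi, prod_const, card_univ, Fintype.card_fin, hS,
        hq, Nat.succ_eq_add_one, Nat.add_sub_cancel, ← sq, ← pow_mul, ← pow_add]
      ring

theorem Fin.sum_univ_pairs {M : Type*} [AddCommMonoid M] (n : ℕ) (h : Fin (2 * n) → M) :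
    ∑ j, h j = ∑ i : Fin n, (h ⟨2 * i, by omega⟩ + h ⟨2 * i + 1, by omega⟩) := by
  induction n with
  | zero => simp
  | succ n ih =>
    rw [Fin.sum_univ_castSucc (n := n)]
    refine Eq.trans ?_ (congrArg (· + _) (ih fun j => h ⟨j, by omega⟩))
    simp only [← add_assoc]
    exact (Fin.sum_univ_castSucc (n := 2 * n + 1) h).trans
      (congrArg (· + _) (Fin.sum_univ_castSucc _))

/-- The elliptic quadratic form agrees with an affine function at
`q ^ (m - 1) + q ^ (m / 2 - 1)` points at most. -/
theorem affineAgreement_ellipticQuadratic_le {a b c : F} (ha : a ≠ 0)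
    (hirr : ∀ x, a * x ^ 2 + c * x + b ≠ 0) {n : ℕ} (hm : 2 ≤ 2 * n + 2)
    (l : Fin (2 * n + 2) → F) (e : F) :
    affineAgreement (ellipticQuadratic hm a b c) l e ≤
      Fintype.card F ^ (2 * n + 1) + Fintype.card F ^ n := by
  have key := card_hyperbolic_sum_add_le
    (fun z : F × F => a * z.1 ^ 2 + b * z.2 ^ 2 + c * (z.1 * z.2) +
      (-l ⟨2 * n, by omega⟩ * z.1 + -l ⟨2 * n + 1, by omega⟩ * z.2)) (by simp [sq])
    (card_conic_le ha hirr (-l ⟨2 * n, by omega⟩) (-l ⟨2 * n + 1, by omega⟩)) n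
    (fun i => -l ⟨2 * i, by omega⟩)
    (fun i => -l ⟨2 * i + 1, by omega⟩) e
  refine le_trans (card_le_card_of_injOn (fun x => (fun i : Fin n => (x ⟨2 * i, by omega⟩,
    x ⟨2 * i + 1, by omega⟩), (x ⟨2 * n, by omega⟩, x ⟨2 * n + 1, by omega⟩))) ?_ ?_) key
  · intro x hx
    have hx' : ellipticQuadratic hm a b c x = l ⬝ᵥ x + e := by simpa using hx
    have hl : l ⬝ᵥ x = ∑ i : Fin (n + 1), (l ⟨2 * i, by omega⟩ * x ⟨2 * i, by omega⟩ +
        l ⟨2 * i + 1, by omega⟩ * x ⟨2 * i + 1, by omega⟩) :=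
      Fin.sum_univ_pairs (n + 1) fun j : Fin (2 * n + 2) => l j * x j
    rw [Fin.sum_univ_castSucc] at hl
    simp only [Fin.val_castSucc, Fin.val_last] at hl
    have hE : ellipticQuadratic hm a b c x =
        (∑ i : Fin n, x ⟨2 * i, by omega⟩ * x ⟨2 * i + 1, by omega⟩)
          + a * x ⟨2 * n, by omega⟩ ^ 2 + b * x ⟨2 * n + 1, by omega⟩ ^ 2
          + c * (x ⟨2 * n, by omega⟩ * x ⟨2 * n + 1, by omega⟩) := by
      have hn : (2 * n + 2) / 2 - 1 = n := by omega
      rw [ellipticQuadratic]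
      congr 3
      exact Fintype.sum_equiv (finCongr hn) _ _ fun i => rfl
    rw [hE, hl] at hx'
    simp only [coe_filter, mem_univ, true_and, Set.mem_ofPred_eq, sum_add_distrib, neg_mul,
      sum_neg_distrib] at hx' ⊢
    linear_combination hx'
  · intro x _ y _ h
    simp only [Prod.mk.injEq] at h
    ext ⟨j, hj⟩
    obtain ⟨h1, h2, h3⟩ := h
    rcases Nat.even_or_odd' j with ⟨i, rfl | rfl⟩
    · rcases eq_or_ne i n with rfl | hi
      · exact h2
      · exact (Prod.ext_iff.1 (congrFun h1 ⟨i, by omega⟩)).1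
    · rcases eq_or_ne i n with rfl | hi
      · exact h3
      · exact (Prod.ext_iff.1 (congrFun h1 ⟨i, by omega⟩)).2

/-- The distance between a function and the first order Reed–Muller code is at most
`(q - 1) q ^ (m - 1) - q ^ (m / 2 - 1)`. -/
theorem distToCode_reedMuller_one_le {n : ℕ} (f : (Fin (2 * n + 2) → F) → F) :
    (distToCode f (reedMuller F 1 (2 * n + 2) : Set ((Fin (2 * n + 2) → F) → F)) : ℤ) ≤
      ((Fintype.card F : ℤ) - 1) * (Fintype.card F : ℤ) ^ (2 * n + 1) -
        (Fintype.card F : ℤ) ^ n := by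
  have h := le_of_forall_affineAgreement_le f
    (T := (Fintype.card F : ℤ) ^ (2 * n + 2) -
      distToCode f (reedMuller F 1 (2 * n + 2) : Set ((Fin (2 * n + 2) → F) → F))) ?_
  · rw [pow_succ' _ (2 * n + 1)] at h
    linarith
  · intro a b
    have h1 := (isLeast_distToCode f (reedMuller_nonempty 1 (2 * n + 2))).2
      ⟨_, mem_reedMuller_one_iff.2 ⟨a, b, rfl⟩, rfl⟩
    have h2 := hammingDist_add_affineAgreement f a b
    zify at h1 h2
    linarith

theorem distToCode_ellipticQuadratic {a b c : F} (ha : a ≠ 0)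
    (hirr : ∀ x, a * x ^ 2 + c * x + b ≠ 0) {n : ℕ} (hm : 2 ≤ 2 * n + 2) :
    (distToCode (ellipticQuadratic hm a b c)
      (reedMuller F 1 (2 * n + 2) : Set ((Fin (2 * n + 2) → F) → F)) : ℤ) =
      ((Fintype.card F : ℤ) - 1) * (Fintype.card F : ℤ) ^ (2 * n + 1) -
        (Fintype.card F : ℤ) ^ n := by
  refine le_antisymm (distToCode_reedMuller_one_le _) ?_
  obtain ⟨g, hg, h⟩ := (isLeast_distToCode (ellipticQuadratic hm a b c)
    (reedMuller_nonempty 1 (2 * n + 2))).1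
  obtain ⟨l, e, rfl⟩ := mem_reedMuller_one_iff.1 hg
  have h1 := affineAgreement_ellipticQuadratic_le ha hirr hm l e
  have h2 := hammingDist_add_affineAgreement (ellipticQuadratic hm a b c) l e
  simp only at h
  rw [h] at h2
  zify at h1 h2
  rw [pow_succ' _ (2 * n + 1)] at h2
  linarith

theorem coveringRadius_reedMuller_one {n : ℕ} :
    (coveringRadius (reedMuller F 1 (2 * n + 2) : Set ((Fin (2 * n + 2) → F) → F)) : ℤ) =
      ((Fintype.card F : ℤ) - 1) * (Fintype.card F : ℤ) ^ (2 * n + 1) -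
        (Fintype.card F : ℤ) ^ n := by
  have hmax := isGreatest_coveringRadius (reedMuller_nonempty (F := F) 1 (2 * n + 2))
  apply le_antisymm
  · obtain ⟨f, hf⟩ := hmax.1
    rw [← hf]
    exact distToCode_reedMuller_one_le f
  -- An elliptic form exists over every finite field, with a = c = 1, so the bound is attained.
  · obtain ⟨b, hb⟩ := exists_forall_sq_add_self_add_ne_zero (F := F)
    rw [← distToCode_ellipticQuadratic (c := 1) one_ne_zero (fun x => by simpa using hb x)
      (by omega)]
    exact_mod_cast hmax.2 ⟨_, rfl⟩

end Elliptic

theorem mainTheorem4 (F : Type*) [Field F] [Fintype F] [DecidableEq F]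
    (m : ℕ) (hm : 2 ≤ m) (hm_even : Even m) :
    (coveringRadius (reedMuller F 1 m : Set ((Fin m → F) → F)) : ℤ)
        = ((Fintype.card F : ℤ) - 1) * (Fintype.card F : ℤ) ^ (m - 1)
          - (Fintype.card F : ℤ) ^ (m / 2 - 1) ∧
      ∀ a b c : F, a ≠ 0 →
        Irreducible (Polynomial.C a * Polynomial.X ^ 2 + Polynomial.C c * Polynomial.X
          + Polynomial.C b : Polynomial F) →
        distToCode (ellipticQuadratic hm a b c) (reedMuller F 1 m : Set ((Fin m → F) → F))
          = coveringRadius (reedMuller F 1 m : Set ((Fin m → F) → F)) := by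
  obtain ⟨n, rfl⟩ : ∃ n, m = 2 * n + 2 := by
    obtain ⟨k, rfl⟩ := hm_even
    exact ⟨k - 1, by omega⟩
  rw [show 2 * n + 2 - 1 = 2 * n + 1 by omega, show (2 * n + 2) / 2 - 1 = n by omega]
  refine ⟨coveringRadius_reedMuller_one, fun a b c ha hirr => ?_⟩
  have hroot : ∀ x, a * x ^ 2 + c * x + b ≠ 0 := by
    intro x hx
    have h := Polynomial.degree_eq_one_of_irreducible_of_root hirr (x := x) (by simpa using hx)
    rw [Polynomial.degree_quadratic ha] at h
    exact absurd h (by decide)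
  exact_mod_cast (distToCode_ellipticQuadratic ha hroot hm).trans
    coveringRadius_reedMuller_one.symm
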